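/- Let $q$ be a prime power and let $n\ge 2$ be an integer. For an $\mathbb F_q$-subspace $U\subsetneq\mathbb F_{q^n}$, let $G_U$ be the undirected graph with vertex set $\mathbb F_{q^n}$ in which two distinct elements $a,b$ are adjacent if and only if $ab\in U$, and let $\omega(G_U)$ be its clique number. Let $\mathrm{Tr}:\mathbb F_{q^n}\to\mathbb F_q$, $\mathrm{Tr}(a)=\sum_{i=0}^{n-1}a^{q^i}$, be the trace map. Put $s(U)=1$ if $U=a^2\ker\mathrm{Tr}$ for some $a\in\mathbb F_{q^n}$ with $a\neq 0$, and $s(U)=-1$ otherwise. Let $U\subsetneq\mathbb F_{q^n}$ be an $\mathbb F_q$-subspace of dimension $n-1$. (A) Suppose that $q>2$ or $n\ge 6$. 1. If $q$ is even or $n$ is odd, then $\omega(G_U)=q^{\lfloor n/2\rfloor}+n-2\lfloor n/2\rfloor$. 2. If $q$ is odd and $n$ is even, then $\omega(G_U)=q^{n/2}$ if $$(q \bmod 4,\ n \bmod 4,\ s(U))\in\{(1,0,-1),\ (3,0,-1),\ (3,2,1),\ (1,2,-1)\},$$ and $\omega(G_U)=q^{n/2-1}+2$ if $$(q \bmod 4,\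 n \bmod 4,\ s(U))\in\{(1,0,1),\ (3,0,1),\ (3,2,-1),\ (1,2,1)\}.$$ (B) If $q=2$ and $2\le n\le 5$, then $\omega(G_U)=n+1$. -/

import Mathlib

/-- The graph `G_U` attached to an `𝔽_q`-subspace `U` of `𝔽_{q^n}`: its vertices are the elements
of `𝔽_{q^n}`, and distinct elements `a`, `b` are adjacent exactly when `a * b ∈ U`. -/
def prodGraph {K L : Type*} [Field K] [Field L] [Algebra K L] (U : Submodule K L) :
    SimpleGraph L where
  Adj a b := a ≠ b ∧ a * b ∈ U
  symm := ⟨fun a b h => ⟨h.1.symm, mul_comm a b ▸ h.2⟩⟩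
  loopless := ⟨fun _ h => h.1 rfl⟩

/-- The space of elements of trace zero. For finite fields with `#K = q` and `[L : K] = n`,
`Algebra.trace K L` is the map `a ↦ ∑ i < n, a ^ (q ^ i)`. -/
noncomputable def traceZero (K L : Type*) [Field K] [Field L] [Algebra K L] : Submodule K L :=
  LinearMap.ker (Algebra.trace K L)

/-- `mulSubspace c V` is the subspace `c V = {c x | x ∈ V}`. -/
def mulSubspace {K L : Type*} [Field K] [Field L] [Algebra K L] (c : L) (V : Submodule K L) :
    Submodule K L :=
  V.map (LinearMap.mulLeft K c)

open Classical in
/-- The sign `s(U)`: it is `1` if `U = a² ker Tr` for some `a ≠ 0`, and `-1` otherwise. -/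
noncomputable def subspaceSign {K L : Type*} [Field K] [Field L] [Algebra K L]
    (U : Submodule K L) : ℤ :=
  if ∃ a : L, a ≠ 0 ∧ U = mulSubspace (a ^ 2) (traceZero K L) then 1 else -1

/-!
A hyperplane of `L` has the form `U = {x | Tr (c * x) = 0}` with `c ≠ 0`, so the graph of `U` is the
orthogonality graph of the nondegenerate symmetric form `B(x, y) = Tr (c * x * y)`. A clique splits
into its isotropic members, which span a totally isotropic subspace `T`, and its anisotropic
members, which form an orthogonal frame of size `k` perpendicular to `T`; hence it has at most
`q ^ dim T + k` elements, and `2 * dim T + k ≤ n` (`exists_card_le_of_isClique`). Conversely a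
totally isotropic subspace of maximal dimension `d` has a frame of size `n - 2 * d` perpendicular
to it, and the union is a clique. For `q > 2`, or `q = 2` and `d ≥ 3`, the clique number is
therefore `q ^ d + (n - 2 * d)` (`IsMaxTotallyIsotropic.cliqueNum_orthoGraph`). For `q = 2` and
`n ≤ 5` the maximum is `n + 1`, reached by an orthogonal basis together with `0`
(`exists_frame_card_eq_finrank`).

The defect `n - 2 * d` is at most `2`, because a ternary quadratic form over a finite field has a
nontrivial zero, and at most `1` in characteristic two, because every element is a square. This
determines `d` unless `q` is odd and `n = 2 * m` is even. In that case `d = m` exactly when `B` is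
hyperbolic, which depends only on the square class of `c`. One class is hyperbolic: with
`Q = q ^ m`, if `c ^ Q = -c`, then the subfield of order `Q` is totally isotropic, and such a `c` is
a square exactly when `Q` is `3` modulo `4`. The other class is not: a hyperbolic form has more
than `q ^ (n - 1)` isotropic vectors, whereas the average over all `c ≠ 0` of the number of
isotropic vectors is exactly `q ^ (n - 1)` (`isHyperbolicScale_iff`). Finally `s(U) = 1` means that
`c` is a square (`subspaceSign_eq_one_iff`).
-/

open Module

/-! ### Orthogonality graphs, isotropic subspaces and frames -/

/-- The graph on `V` in which distinct vectors are adjacent exactly when they are orthogonal for the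
symmetric bilinear form `B`. -/
def orthoGraph {K V : Type*} [Field K] [AddCommGroup V] [Module K V]
    (B : LinearMap.BilinForm K V) (hB : B.IsSymm) : SimpleGraph V where
  Adj a b := a ≠ b ∧ B a b = 0
  symm := ⟨fun a b h => ⟨h.1.symm, by rw [hB.eq b a]; exact h.2⟩⟩
  loopless := ⟨fun _ h => h.1 rfl⟩

section Forms

variable {K V : Type*} [Field K] [AddCommGroup V] [Module K V]

/-- `B` vanishes identically on the subspace `T`. -/
def IsTotallyIsotropic (B : LinearMap.BilinForm K V) (T : Submodule K V) : Prop :=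
  ∀ x ∈ T, ∀ y ∈ T, B x y = 0

/-- A finite set of pairwise orthogonal anisotropic vectors. -/
structure IsFrame (B : LinearMap.BilinForm K V) (N : Finset V) : Prop where
  anisotropic : ∀ x ∈ N, B x x ≠ 0
  orthogonal : ∀ x ∈ N, ∀ y ∈ N, x ≠ y → B x y = 0

variable {B : LinearMap.BilinForm K V}

theorem IsFrame.linearIndepOn {N : Finset V} (hN : IsFrame B N) :
    LinearIndepOn K id (N : Set V) := by
  refine LinearMap.BilinForm.linearIndependent_of_iIsOrtho (B := B) ?_ ?_
  · rw [LinearMap.BilinForm.iIsOrtho_def]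
    intro i j hij
    exact hN.orthogonal _ i.2 _ j.2 fun h => hij (Subtype.ext h)
  · intro i
    exact hN.anisotropic _ i.2

theorem IsFrame.finrank_span {N : Finset V} (hN : IsFrame B N) :
    finrank K (Submodule.span K (N : Set V)) = N.card :=
  finrank_span_finset_eq_card hN.linearIndepOn

/-- The form is nondegenerate on the span of a frame. -/
theorem IsFrame.eq_zero_of_mem_span {N : Finset V} (hN : IsFrame B N) {x : V}
    (hx : x ∈ Submodule.span K (N : Set V)) (h : ∀ s ∈ N, B s x = 0) : x = 0 := by
  obtain ⟨f, -, rfl⟩ := Submodule.mem_span_finset.1 hx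
  refine Finset.sum_eq_zero fun s hs => ?_
  have h1 := h s hs
  rw [map_sum, Finset.sum_eq_single_of_mem s hs] at h1
  · rw [map_smul, smul_eq_mul] at h1
    rw [(mul_eq_zero.1 h1).resolve_right (hN.anisotropic s hs), zero_smul]
  · intro t ht hts
    rw [map_smul, hN.orthogonal s hs t ht hts.symm, smul_zero]

theorem IsFrame.insert [DecidableEq V] (hB : B.IsSymm) {N : Finset V} (hN : IsFrame B N) {v : V}
    (hv : B v v ≠ 0) (hvN : ∀ s ∈ N, B s v = 0) : IsFrame B (insert v N) where
  anisotropic x hx := by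
    rcases Finset.mem_insert.1 hx with rfl | hx
    exacts [hv, hN.anisotropic x hx]
  orthogonal x hx y hy hxy := by
    rcases Finset.mem_insert.1 hx with hx | hx <;> rcases Finset.mem_insert.1 hy with hy | hy
    · exact absurd (hx.trans hy.symm) hxy
    · rw [hx, hB.eq]; exact hvN y hy
    · rw [hy]; exact hvN x hx
    · exact hN.orthogonal x hx y hy hxy

theorem IsFrame.mono {N M : Finset V} (hN : IsFrame B N) (h : M ⊆ N) : IsFrame B M :=
  ⟨fun x hx => hN.anisotropic x (h hx), fun x hx y hy => hN.orthogonal x (h hx) y (h hy)⟩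

theorem mem_orthogonal_span_iff {s : Set V} {x : V} :
    x ∈ B.orthogonal (Submodule.span K s) ↔ ∀ y ∈ s, B y x = 0 := by
  rw [LinearMap.BilinForm.mem_orthogonal_iff]
  refine ⟨fun h y hy => h y (Submodule.subset_span hy), fun h y hy => ?_⟩
  refine Submodule.span_induction (p := fun y _ => B y x = 0) h (by simp) ?_ ?_ hy
  · intro a b _ _ ha hb; rw [map_add, LinearMap.add_apply, ha, hb, add_zero]
  · intro a b _ hb; rw [map_smul, LinearMap.smul_apply, hb, smul_zero]

/-- If a totally isotropic subspace `T` is orthogonal to a frame with span `W`, then `T` meets `W`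
trivially and lies in the orthogonal complement of `T ⊔ W`. -/
theorem IsTotallyIsotropic.two_mul_finrank_add_card_le [FiniteDimensional K V]
    (hnd : B.Nondegenerate)
    {T : Submodule K V} (hT : IsTotallyIsotropic B T) {N : Finset V} (hN : IsFrame B N)
    (h : ∀ x ∈ T, ∀ s ∈ N, B s x = 0) : 2 * finrank K T + N.card ≤ finrank K V := by
  set W := Submodule.span K (N : Set V) with hW
  have hTW : T ⊓ W = ⊥ := by
    rw [Submodule.eq_bot_iff]
    rintro x ⟨hxT, hxW⟩
    exact hN.eq_zero_of_mem_span hxW (h x hxT)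
  have h1 : finrank K (T ⊔ W : Submodule K V) = finrank K T + N.card := by
    have := Submodule.finrank_sup_add_finrank_inf_eq T W
    rw [hTW, finrank_bot, hN.finrank_span] at this
    simpa using this
  have h2 : T ≤ B.orthogonal (T ⊔ W) := by
    intro x hx
    rw [LinearMap.BilinForm.mem_orthogonal_iff]
    intro y hy
    obtain ⟨t, ht, w, hw, rfl⟩ := Submodule.mem_sup.1 hy
    have := LinearMap.BilinForm.mem_orthogonal_iff.1
      (mem_orthogonal_span_iff.2 (h x hx) : x ∈ B.orthogonal W) w hw
    rw [map_add, LinearMap.add_apply, hT t ht x hx, this, add_zero]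
  have h3 := Submodule.finrank_mono h2
  rw [LinearMap.BilinForm.finrank_orthogonal hnd, h1] at h3
  have h4 := Submodule.finrank_le (T ⊔ W)
  omega

/-- The isotropic members of a clique span a totally isotropic subspace `T`, and the `k` anisotropic
ones form a frame orthogonal to `T`. -/
theorem exists_card_le_of_isClique [Finite K] [FiniteDimensional K V]
    (hB : B.IsSymm) (hnd : B.Nondegenerate)
    {C : Finset V} (hC : (orthoGraph B hB).IsClique C) :
    ∃ (T : Submodule K V) (k : ℕ), IsTotallyIsotropic B T ∧ 2 * finrank K T + k ≤ finrank K V ∧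
      C.card ≤ Nat.card K ^ finrank K T + k := by
  classical
  have hC' : ∀ x ∈ C, ∀ y ∈ C, x ≠ y → B x y = 0 := fun x hx y hy hxy =>
    (hC (Finset.mem_coe.2 hx) (Finset.mem_coe.2 hy) hxy).2
  set I := C.filter fun x => B x x = 0 with hI
  set N := C.filter fun x => ¬ B x x = 0 with hN
  have hNf : IsFrame B N := ⟨fun x hx => (Finset.mem_filter.1 hx).2, fun x hx y hy =>
    hC' x (Finset.mem_filter.1 hx).1 y (Finset.mem_filter.1 hy).1⟩
  have hCI : ∀ x ∈ C, ∀ y ∈ I, B x y = 0 := by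
    intro x hx y hy
    by_cases hxy : x = y
    · rw [hxy]; exact (Finset.mem_filter.1 hy).2
    · exact hC' x hx y (Finset.mem_filter.1 hy).1 hxy
  have hspan : ∀ x ∈ C, ∀ y ∈ Submodule.span K (I : Set V), B x y = 0 := by
    intro x hx y hy
    rw [hB.eq]
    exact LinearMap.BilinForm.mem_orthogonal_iff.1
      (mem_orthogonal_span_iff.2 fun z hz => by rw [hB.eq]; exact hCI x hx z hz :
        x ∈ B.orthogonal (Submodule.span K (I : Set V))) y hy
  have hT : IsTotallyIsotropic B (Submodule.span K (I : Set V)) := by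
    intro x hx y hy
    exact LinearMap.BilinForm.mem_orthogonal_iff.1
      (mem_orthogonal_span_iff.2 fun z hz => hspan z (Finset.mem_filter.1 hz).1 y hy :
        y ∈ B.orthogonal (Submodule.span K (I : Set V))) x hx
  refine ⟨_, N.card, hT, hT.two_mul_finrank_add_card_le hnd hNf fun x hx s hs =>
    hspan s (Finset.mem_filter.1 hs).1 x hx, ?_⟩
  rw [← Finset.card_filter_add_card_filter_not (s := C) fun x => B x x = 0,
    ← Module.natCard_eq_pow_finrank]
  refine Nat.add_le_add_right ?_ _
  have : Finite V := Module.finite_of_finite K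
  rw [← Nat.card_eq_finsetCard]
  exact Nat.card_le_card_of_injective
    (fun x : {x // x ∈ I} => (⟨x, Submodule.subset_span x.2⟩ : Submodule.span K (I : Set V)))
    fun x y h => Subtype.ext (congrArg (fun z : Submodule.span K (I : Set V) => (z : V)) h)

/-- A totally isotropic subspace together with a frame orthogonal to it is a clique. -/
theorem le_cliqueNum_orthoGraph [Finite K] [FiniteDimensional K V]
    (hB : B.IsSymm) {T : Submodule K V} (hT : IsTotallyIsotropic B T) {N : Finset V}
    (hN : IsFrame B N) (h : ∀ s ∈ N, s ∈ B.orthogonal T) :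
    Nat.card K ^ finrank K T + N.card ≤ (orthoGraph B hB).cliqueNum := by
  classical
  have : Finite V := Module.finite_of_finite K
  have := Fintype.ofFinite V
  have hTN : ∀ s ∈ N, ∀ t ∈ T, B t s = 0 := fun s hs t ht =>
    LinearMap.BilinForm.mem_orthogonal_iff.1 (h s hs) t ht
  set C : Finset V := Finset.univ.filter (· ∈ T) with hCdef
  have hdisj : Disjoint C N := by
    rw [Finset.disjoint_left]
    intro x hx hxN
    exact hN.anisotropic x hxN (hTN x hxN x (Finset.mem_filter.1 hx).2)
  have hcl : (orthoGraph B hB).IsClique (C ∪ N : Finset V) := by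
    intro x hx y hy hxy
    refine ⟨hxy, ?_⟩
    rcases Finset.mem_union.1 (Finset.mem_coe.1 hx) with hx | hx <;>
      rcases Finset.mem_union.1 (Finset.mem_coe.1 hy) with hy | hy
    · exact hT x (Finset.mem_filter.1 hx).2 y (Finset.mem_filter.1 hy).2
    · exact hTN y hy x (Finset.mem_filter.1 hx).2
    · rw [hB.eq]; exact hTN x hx y (Finset.mem_filter.1 hy).2
    · exact hN.orthogonal x hx y hy hxy
  have := hcl.card_le_cliqueNum
  rw [Finset.card_union_of_disjoint hdisj] at this
  convert this using 2
  rw [← Module.natCard_eq_pow_finrank, Nat.card_eq_fintype_card, hCdef, ← Fintype.card_subtype]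

/-- `T` is a totally isotropic subspace of the largest possible dimension. -/
structure IsMaxTotallyIsotropic (B : LinearMap.BilinForm K V) (T : Submodule K V) : Prop where
  isotropic : IsTotallyIsotropic B T
  finrank_le : ∀ S : Submodule K V, IsTotallyIsotropic B S → finrank K S ≤ finrank K T

theorem exists_isMaxTotallyIsotropic [FiniteDimensional K V] (B : LinearMap.BilinForm K V) :
    ∃ T, IsMaxTotallyIsotropic B T := by
  classical
  have h0 : ∃ d, ∃ T : Submodule K V, IsTotallyIsotropic B T ∧ finrank K T = d :=
    ⟨_, ⊥, by intro x hx y _; rw [(Submodule.mem_bot K).1 hx, map_zero, LinearMap.zero_apply], rfl⟩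
  have hb : ∀ d, (∃ T : Submodule K V, IsTotallyIsotropic B T ∧ finrank K T = d) →
      d ≤ finrank K V := by
    rintro d ⟨T, -, rfl⟩
    exact Submodule.finrank_le T
  obtain ⟨d0, hd0⟩ := h0
  obtain ⟨T, hT, hTd⟩ := Nat.findGreatest_spec (P := fun d =>
    ∃ T : Submodule K V, IsTotallyIsotropic B T ∧ finrank K T = d) (hb d0 hd0) hd0
  refine ⟨T, hT, fun S hS => ?_⟩
  rw [hTd]
  exact Nat.le_findGreatest (Submodule.finrank_le S) ⟨S, hS, rfl⟩

/-- Otherwise `T` could be enlarged by `v`. -/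
theorem IsMaxTotallyIsotropic.mem_of_isotropic [FiniteDimensional K V] (hB : B.IsSymm)
    {T : Submodule K V} (hT : IsMaxTotallyIsotropic B T) {v : V} (hv : v ∈ B.orthogonal T)
    (hvv : B v v = 0) : v ∈ T := by
  have hTv : ∀ t ∈ T, B t v = 0 := fun t ht => LinearMap.BilinForm.mem_orthogonal_iff.1 hv t ht
  have h1 : IsTotallyIsotropic B (T ⊔ Submodule.span K {v}) := by
    intro x hx y hy
    obtain ⟨a, ha, b, hb, rfl⟩ := Submodule.mem_sup.1 hx
    obtain ⟨c, hc, d, hd, rfl⟩ := Submodule.mem_sup.1 hy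
    obtain ⟨r, rfl⟩ := Submodule.mem_span_singleton.1 hb
    obtain ⟨s, rfl⟩ := Submodule.mem_span_singleton.1 hd
    simp [hT.isotropic a ha c hc, hTv a ha, hvv, hB.eq v c, hTv c hc]
  have h2 := Submodule.eq_of_le_of_finrank_le (le_sup_left : T ≤ T ⊔ Submodule.span K {v})
    (hT.finrank_le _ h1)
  rw [h2]
  exact Submodule.mem_sup_right (Submodule.mem_span_singleton_self v)

/-- Every vector orthogonal to a maximal `T` but outside `T` is anisotropic, so a frame orthogonal to
`T` can be extended as long as the dimension leaves room. -/
theorem IsMaxTotallyIsotropic.exists_frame [FiniteDimensional K V] (hB : B.IsSymm)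
    (hnd : B.Nondegenerate) {T : Submodule K V} (hT : IsMaxTotallyIsotropic B T) {k : ℕ}
    (hk : 2 * finrank K T + k ≤ finrank K V) :
    ∃ N : Finset V, IsFrame B N ∧ N.card = k ∧ ∀ s ∈ N, s ∈ B.orthogonal T := by
  classical
  induction k with
  | zero => exact ⟨∅, ⟨by simp, by simp⟩, rfl, by simp⟩
  | succ k ih =>
    obtain ⟨N, hN, hNk, hNT⟩ := ih (by omega)
    set W := T ⊔ Submodule.span K (N : Set V) with hW
    have h1 : finrank K W ≤ finrank K T + k := by
      refine (Submodule.finrank_add_le_finrank_add_finrank _ _).trans ?_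
      rw [hN.finrank_span, hNk]
    have h2 := LinearMap.BilinForm.finrank_orthogonal hnd W
    have h3 : ¬ B.orthogonal W ≤ T := fun h => by
      have := Submodule.finrank_mono h
      omega
    obtain ⟨v, hvW, hvT⟩ := SetLike.not_le_iff_exists.1 h3
    have hvO : v ∈ B.orthogonal T := LinearMap.BilinForm.orthogonal_le le_sup_left hvW
    have hvN : ∀ s ∈ N, B s v = 0 := mem_orthogonal_span_iff.1
      (LinearMap.BilinForm.orthogonal_le le_sup_right hvW)
    have hvv : B v v ≠ 0 := fun h => hvT (hT.mem_of_isotropic hB hvO h)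
    refine ⟨insert v N, hN.insert hB hvv hvN, ?_, ?_⟩
    · rw [Finset.card_insert_of_notMem fun h => hvv (hvN v h), hNk]
    · intro s hs
      rcases Finset.mem_insert.1 hs with rfl | hs
      exacts [hvO, hNT s hs]

/-- Over a finite field of characteristic two, a frame `{v, w}` orthogonal to a maximal `T` would
give the isotropic vector `v + r • w` with `r² = B v v / B w w`. -/
theorem IsMaxTotallyIsotropic.finrank_le_add_one [Finite K] [FiniteDimensional K V] (hB : B.IsSymm)
    (hnd : B.Nondegenerate) {T : Submodule K V} (hT : IsMaxTotallyIsotropic B T)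
    (hK : Even (Nat.card K)) : finrank K V ≤ 2 * finrank K T + 1 := by
  classical
  have := Fintype.ofFinite K
  by_contra! hlt
  obtain ⟨N, hN, hN2, hNT⟩ := hT.exists_frame hB hnd (k := 2) hlt
  obtain ⟨v, w, hvw, rfl⟩ := Finset.card_eq_two.1 hN2
  have hchar : ringChar K = 2 := FiniteField.even_card_iff_char_two.2 (by
    rw [← Nat.card_eq_fintype_card]; exact Nat.even_iff.1 hK)
  have : CharP K 2 := ringChar.of_eq hchar
  have hv := hN.anisotropic v (by simp)
  have hw := hN.anisotropic w (by simp)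
  have hvw0 := hN.orthogonal v (by simp) w (by simp) hvw
  have hwv0 := hN.orthogonal w (by simp) v (by simp) hvw.symm
  obtain ⟨r, hr⟩ := FiniteField.isSquare_of_char_two hchar (B v v / B w w)
  have hr0 : r ≠ 0 := by
    rintro rfl
    exact div_ne_zero hv hw (by simpa using hr)
  have hz : B (v + r • w) (v + r • w) = 0 := by
    have : B (v + r • w) (v + r • w) = B v v + r * r * B w w := by
      simp [hvw0, hwv0]; ring
    rw [this, ← hr, div_mul_cancel₀ _ hw, CharTwo.add_self_eq_zero]
  have hmem := hT.mem_of_isotropic hB (Submodule.add_mem _ (hNT v (by simp))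
    (Submodule.smul_mem _ r (hNT w (by simp)))) hz
  have := LinearMap.BilinForm.mem_orthogonal_iff.1 (hNT w (by simp)) _ hmem
  simp [hvw0, hr0, hw] at this

/-- Over a finite field of odd order, a frame `{u, v, w}` orthogonal to a maximal `T` would give an
isotropic vector `a • u + b • v + w`, because `B u u * a² + B v v * b² + B w w` has a zero. -/
theorem IsMaxTotallyIsotropic.finrank_le_add_two [Finite K] [FiniteDimensional K V] (hB : B.IsSymm)
    (hnd : B.Nondegenerate) {T : Submodule K V} (hT : IsMaxTotallyIsotropic B T) :
    finrank K V ≤ 2 * finrank K T + 2 := by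
  classical
  have := Fintype.ofFinite K
  rcases Nat.even_or_odd (Nat.card K) with hK | hK
  · have := hT.finrank_le_add_one hB hnd hK
    omega
  by_contra! hlt
  obtain ⟨N, hN, hN3, hNT⟩ := hT.exists_frame hB hnd (k := 3) hlt
  obtain ⟨u, v, w, huv, huw, hvw, rfl⟩ := Finset.card_eq_three.1 hN3
  have hu := hN.anisotropic u (by simp)
  have hv := hN.anisotropic v (by simp)
  have hw := hN.anisotropic w (by simp)
  have o1 := hN.orthogonal u (by simp) v (by simp) huv
  have o2 := hN.orthogonal u (by simp) w (by simp) huw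
  have o3 := hN.orthogonal v (by simp) w (by simp) hvw
  have o1' := hN.orthogonal v (by simp) u (by simp) huv.symm
  have o2' := hN.orthogonal w (by simp) u (by simp) huw.symm
  have o3' := hN.orthogonal w (by simp) v (by simp) hvw.symm
  obtain ⟨a, b, hab⟩ := FiniteField.exists_root_sum_quadratic
    (f := Polynomial.C (B u u) * Polynomial.X ^ 2 + Polynomial.C 0 * Polynomial.X +
      Polynomial.C (B w w))
    (g := Polynomial.C (B v v) * Polynomial.X ^ 2 + Polynomial.C 0 * Polynomial.X +
      Polynomial.C 0) (Polynomial.degree_quadratic hu) (Polynomial.degree_quadratic hv)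
    (by rw [← Nat.card_eq_fintype_card]; exact Nat.odd_iff.1 hK)
  have hz : B (a • u + b • v + w) (a • u + b • v + w) = 0 := by
    simp [o1, o2, o3, o1', o2', o3'] at hab ⊢
    linear_combination hab
  have hmem := hT.mem_of_isotropic hB (Submodule.add_mem _ (Submodule.add_mem _
    (Submodule.smul_mem _ a (hNT u (by simp)))
    (Submodule.smul_mem _ b (hNT v (by simp)))) (hNT w (by simp))) hz
  have := LinearMap.BilinForm.mem_orthogonal_iff.1 (hNT w (by simp)) _ hmem
  simp [o2, o3, hw] at this

/-! ### Forms over the field with two elements -/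

/-- Over the field with two elements, a nondegenerate symmetric form that is not alternating has an
orthogonal basis of anisotropic vectors. A frame `N` of maximal size spans `V`: otherwise its
orthogonal complement is alternating and contains `e`, `f` with `B e f = 1`, and replacing some
`v ∈ N` by `v + e`, `v + f`, `v + e + f` gives a larger frame. -/
theorem exists_frame_card_eq_finrank [FiniteDimensional K V] (hB : B.IsSymm)
    (hnd : B.Nondegenerate) (hK : Nat.card K = 2) (hne : ∃ x, B x x ≠ 0) :
    ∃ N : Finset V, IsFrame B N ∧ N.card = finrank K V := by
  classical
  have hfin : Finite K := Nat.finite_of_card_ne_zero (by omega)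
  have := Fintype.ofFinite K
  have hone : ∀ a : K, a ≠ 0 → a = 1 := by
    intro a ha
    by_contra h1
    have h3 : ({0, 1, a} : Finset K).card = 3 := by
      rw [Finset.card_eq_three]
      exact ⟨0, 1, a, zero_ne_one, Ne.symm ha, Ne.symm h1, rfl⟩
    have := Finset.card_le_univ ({0, 1, a} : Finset K)
    rw [h3, ← Nat.card_eq_fintype_card, hK] at this
    omega
  have hchar : ringChar K = 2 := FiniteField.even_card_iff_char_two.2 (by
    rw [← Nat.card_eq_fintype_card, hK])
  have : CharP K 2 := ringChar.of_eq hchar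
  have h0 : ∃ N : Finset V, IsFrame B N ∧ N.card = 0 := ⟨∅, ⟨by simp, by simp⟩, rfl⟩
  have hle : ∀ N : Finset V, IsFrame B N → N.card ≤ finrank K V := fun N hN => by
    rw [← hN.finrank_span]; exact Submodule.finrank_le _
  obtain ⟨N, hN, hNd⟩ := Nat.findGreatest_spec (P := fun d =>
    ∃ N : Finset V, IsFrame B N ∧ N.card = d) (Nat.zero_le (finrank K V)) h0
  have hmax : ∀ M : Finset V, IsFrame B M → M.card ≤ N.card := fun M hM => by
    rw [hNd]
    exact Nat.le_findGreatest (hle M hM) ⟨M, hM, rfl⟩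
  refine ⟨N, hN, (hle N hN).antisymm ?_⟩
  by_contra! hlt
  have hNss : ∀ s ∈ N, B s s = 1 := fun s hs => hone _ (hN.anisotropic s hs)
  have hiso : ∀ x, (∀ s ∈ N, B s x = 0) → B x x = 0 := by
    intro x hx
    by_contra hxx
    have := hmax _ (hN.insert hB hxx hx)
    rw [Finset.card_insert_of_notMem fun h => hxx (hx x h)] at this
    omega
  obtain ⟨v, hv⟩ : N.Nonempty := by
    rw [Finset.nonempty_iff_ne_empty]
    rintro rfl
    obtain ⟨x, hx⟩ := hne
    exact hx (hiso x (by simp))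
  have h1 : B.orthogonal (Submodule.span K (N : Set V)) ≠ ⊥ := by
    intro h
    have h2 := LinearMap.BilinForm.finrank_orthogonal hnd (Submodule.span K (N : Set V))
    rw [h, finrank_bot, hN.finrank_span] at h2
    omega
  obtain ⟨e, heN, he0⟩ := Submodule.exists_mem_ne_zero_of_ne_bot h1
  rw [mem_orthogonal_span_iff] at heN
  obtain ⟨g, hg⟩ : ∃ g, B e g ≠ 0 := by
    by_contra! h
    exact he0 (hnd.1 e h)
  set f := g - ∑ s ∈ N, B s g • s with hf
  have hfN : ∀ s ∈ N, B s f = 0 := by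
    intro s hs
    rw [hf, map_sub, map_sum, Finset.sum_eq_single_of_mem s hs, map_smul, hNss s hs,
      smul_eq_mul, mul_one, sub_self]
    intro t ht hts
    rw [map_smul, hN.orthogonal s hs t ht hts.symm, smul_zero]
  have hef : B e f = 1 := by
    apply hone
    rw [hf, map_sub, map_sum, Finset.sum_eq_zero, sub_zero]
    · exact hg
    · intro s hs
      rw [map_smul, hB.eq e s, heN s hs, smul_zero]
  have hfe : B f e = 1 := by rw [hB.eq]; exact hef
  have hee := hiso e heN
  have hff := hiso f hfN
  have hve := heN v hv
  have hvf := hfN v hv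
  have hev : B e v = 0 := by rw [hB.eq]; exact hve
  have hfv : B f v = 0 := by rw [hB.eq]; exact hvf
  have hvv := hNss v hv
  have h2 : (1 : K) + 1 = 0 := CharTwo.add_self_eq_zero 1
  have hN' : IsFrame B (N.erase v) := hN.mono (Finset.erase_subset _ _)
  have hout : ∀ s ∈ N.erase v, B s v = 0 ∧ B s e = 0 ∧ B s f = 0 := fun s hs =>
    have hs' := Finset.mem_erase.1 hs
    ⟨hN.orthogonal s hs'.2 v hv hs'.1, heN s hs'.2, hfN s hs'.2⟩
  have a1 : B (v + e) (v + e) = 1 := by simp [hvv, hve, hev, hee]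
  have a2 : B (v + f) (v + f) = 1 := by simp [hvv, hvf, hfv, hff]
  have a3 : B (v + e + f) (v + e + f) = 1 := by
    simp [hvv, hvf, hfv, hff, hve, hev, hee, hef, hfe, add_assoc, h2]
  have b12 : B (v + e) (v + f) = 0 := by simp [hvv, hvf, hev, hef, h2]
  have b13 : B (v + e) (v + e + f) = 0 := by simp [hvv, hvf, hve, hev, hee, hef, h2]
  have b23 : B (v + f) (v + e + f) = 0 := by simp [hvv, hvf, hve, hfv, hff, hfe, h2]
  have o1 : ∀ s ∈ N.erase v, B s (v + e) = 0 := fun s hs => by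
    simp [(hout s hs).1, (hout s hs).2.1]
  have f1 := hN'.insert hB (by rw [a1]; exact one_ne_zero) o1
  have o2 : ∀ s ∈ insert (v + e) (N.erase v), B s (v + f) = 0 := fun s hs => by
    rcases Finset.mem_insert.1 hs with rfl | hs
    · exact b12
    · simp [(hout s hs).1, (hout s hs).2.2]
  have f2 := f1.insert hB (by rw [a2]; exact one_ne_zero) o2
  have o3 : ∀ s ∈ insert (v + f) (insert (v + e) (N.erase v)), B s (v + e + f) = 0 :=
    fun s hs => by
      rcases Finset.mem_insert.1 hs with rfl | hs
      · exact b23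
      rcases Finset.mem_insert.1 hs with rfl | hs
      · exact b13
      · simp [(hout s hs).1, (hout s hs).2.1, (hout s hs).2.2]
  have f3 := f2.insert hB (by rw [a3]; exact one_ne_zero) o3
  have hc := hmax _ f3
  rw [Finset.card_insert_of_notMem fun h => one_ne_zero (a3.symm.trans (o3 _ h)),
    Finset.card_insert_of_notMem fun h => one_ne_zero (a2.symm.trans (o2 _ h)),
    Finset.card_insert_of_notMem fun h => one_ne_zero (a1.symm.trans (o1 _ h)),
    Finset.card_erase_of_mem hv] at hc
  have := Finset.card_pos.2 ⟨v, hv⟩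
  omega

/-! ### Counting isotropic vectors -/

/-- All fibres of a nonzero linear functional on a finite space have the same size. -/
theorem card_eq_mul_card_fiber [Fintype K] [DecidableEq K] {M : Type*} [AddCommGroup M] [Module K M]
    [Fintype M] {f : M →ₗ[K] K} (hf : f ≠ 0) (a : K) :
    Fintype.card M = Fintype.card K * (Finset.univ.filter fun x => f x = a).card := by
  have hsurj : Function.Surjective f := LinearMap.surjective hf
  rw [← Finset.card_univ, Finset.card_eq_sum_card_fiberwise
    (f := f) (t := Finset.univ) (fun _ _ => Finset.mem_coe.2 (Finset.mem_univ _)),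
    Finset.sum_const_nat (m := (Finset.univ.filter fun x => f x = a).card), Finset.card_univ]
  intro b _
  exact AddMonoidHom.card_fiber_eq_of_mem_range f.toAddMonoidHom (hsurj b) (hsurj a)

/-- If `T` is totally isotropic of half the dimension, then more than `#V / #K` vectors are isotropic.
On a coset `x + T` with `x ∉ T` the quadratic form is a nonconstant affine function, because
`T` is its own orthogonal complement, so exactly `#T / #K` vectors there are isotropic; on `T`
itself all are. -/
theorem IsTotallyIsotropic.card_lt_mul_card_isotropic [Fintype K] [Fintype V] [DecidableEq K]
    (hB : B.IsSymm)
    (hnd : B.Nondegenerate) (h2 : (2 : K) ≠ 0) {T : Submodule K V} (hT : IsTotallyIsotropic B T)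
    (hd : 2 * finrank K T = finrank K V) :
    Fintype.card V < Fintype.card K * (Finset.univ.filter fun x : V => B x x = 0).card := by
  classical
  have hTperp : B.orthogonal T = T := by
    refine (Submodule.eq_of_le_of_finrank_le (fun x hx => ?_) ?_).symm
    · exact LinearMap.BilinForm.mem_orthogonal_iff.2 fun t ht => hT t ht x hx
    · rw [LinearMap.BilinForm.finrank_orthogonal hnd]
      omega
  -- Count the pairs `(x, t)` with `x + t` isotropic. For each `x` there are at least `#T / #K` such
  -- `t ∈ T`, and for `x = 0` strictly more; for each `t` the number of `x` is the same.
  have hcount : ∀ x : V, Fintype.card T ≤ Fintype.card K *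
      (Finset.univ.filter fun t : T => B (x + t) (x + t) = 0).card := by
    intro x
    by_cases hx : x ∈ T
    · rw [Finset.filter_true_of_mem fun t _ => hT _ (T.add_mem hx t.2) _ (T.add_mem hx t.2),
        Finset.card_univ]
      exact Nat.le_mul_of_pos_left _ Fintype.card_pos
    · set f : T →ₗ[K] K := (2 : K) • (B x).domRestrict T with hf
      have hfne : f ≠ 0 := by
        intro h0
        apply hx
        rw [← hTperp, LinearMap.BilinForm.mem_orthogonal_iff]
        intro t ht
        have := LinearMap.congr_fun h0 ⟨t, ht⟩
        rw [hB.eq]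
        simpa [hf, h2] using this
      rw [card_eq_mul_card_fiber hfne (-(B x x))]
      refine (congrArg _ (congrArg _ (Finset.filter_congr fun t _ => ?_))).le
      have : B (x + t) (x + t) = B x x + f t := by
        simp [hf, hT t t.2 t t.2, hB.eq (t : V) x]; ring
      rw [this, eq_neg_iff_add_eq_zero, add_comm]
  have hzero : Fintype.card T < Fintype.card K *
      (Finset.univ.filter fun t : T => B ((0 : V) + t) ((0 : V) + t) = 0).card := by
    rw [Finset.filter_true_of_mem fun t _ => by rw [zero_add]; exact hT _ t.2 _ t.2,
      Finset.card_univ]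
    exact lt_mul_of_one_lt_left Fintype.card_pos Fintype.one_lt_card
  have hsum := Finset.sum_lt_sum (s := Finset.univ) (fun x _ => hcount x)
    ⟨0, Finset.mem_univ _, hzero⟩
  rw [Finset.sum_const, Finset.card_univ, smul_eq_mul, ← Finset.mul_sum] at hsum
  simp_rw [Finset.card_filter] at hsum
  rw [Finset.sum_comm] at hsum
  have hshift : ∀ t : T, (∑ x : V, if B (x + t) (x + t) = 0 then 1 else 0) =
      (Finset.univ.filter fun x : V => B x x = 0).card := fun t => by
    rw [Finset.card_filter]
    exact Equiv.sum_comp (Equiv.addRight (t : V)) fun x => if B x x = 0 then 1 else 0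
  rw [Finset.sum_congr rfl fun t _ => hshift t, Finset.sum_const, Finset.card_univ, smul_eq_mul,
    mul_left_comm, mul_comm (Fintype.card V)] at hsum
  exact lt_of_mul_lt_mul_left hsum (Nat.zero_le _)

/-! ### Clique numbers of orthogonality graphs -/

theorem cliqueNum_orthoGraph_le [Finite K] [FiniteDimensional K V] (hB : B.IsSymm)
    (hnd : B.Nondegenerate) {c : ℕ}
    (hc : ∀ (T : Submodule K V) (k : ℕ), IsTotallyIsotropic B T →
      2 * finrank K T + k ≤ finrank K V → Nat.card K ^ finrank K T + k ≤ c) :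
    (orthoGraph B hB).cliqueNum ≤ c := by
  have : Finite V := Module.finite_of_finite K
  obtain ⟨C, hC⟩ := (orthoGraph B hB).exists_isNClique_cliqueNum
  obtain ⟨T, k, hT, hk, hle⟩ := exists_card_le_of_isClique hB hnd hC.isClique
  rw [← hC.card_eq]
  exact hle.trans (hc T k hT hk)

/-- The clique size `q ^ e + (n - 2 * e)` is monotone in `e` for `q ≥ 3`. For `q = 2` its values at
`e = 0, 1, 2` are `n + 1, n, n`, so that `d ≥ 3` is needed. -/
theorem pow_add_sub_le_pow_add_sub {q n d e : ℕ} (h : 2 < q ∨ 2 = q ∧ 3 ≤ d) (hed : e ≤ d)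
    (hd : 2 * d ≤ n) : q ^ e + (n - 2 * e) ≤ q ^ d + (n - 2 * d) := by
  suffices q ^ e + 2 * (d - e) ≤ q ^ d by omega
  rcases h with hq | ⟨rfl, hd3⟩
  · obtain ⟨k, rfl⟩ := Nat.exists_eq_add_of_le hed
    clear hed hd
    induction k with
    | zero => simp
    | succ k ih =>
      have h1 : 0 < q ^ (e + k) := Nat.pow_pos (by omega)
      have h2 : q ^ (e + (k + 1)) = q ^ (e + k) * q := by rw [← add_assoc, pow_succ]
      have h3 : q ^ (e + k) * 3 ≤ q ^ (e + k) * q := Nat.mul_le_mul_left _ hq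
      omega
  · rcases Nat.lt_or_ge e 3 with he | he
    · have h8 : 2 * d + 2 ≤ 2 ^ d := by
        clear hed hd
        induction d, hd3 using Nat.le_induction with
        | base => norm_num
        | succ k hk ih => rw [pow_succ]; omega
      interval_cases e <;> omega
    · obtain ⟨k, rfl⟩ := Nat.exists_eq_add_of_le hed
      clear hed hd hd3
      induction k with
      | zero => simp
      | succ k ih =>
        have h1 : 2 ^ 1 ≤ 2 ^ (e + k) := Nat.pow_le_pow_right (by omega) (by omega)
        have h2 : 2 ^ (e + (k + 1)) = 2 ^ (e + k) * 2 := by rw [← add_assoc, pow_succ]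
        omega

theorem IsMaxTotallyIsotropic.cliqueNum_orthoGraph [Finite K] [FiniteDimensional K V]
    (hB : B.IsSymm) (hnd : B.Nondegenerate) {T : Submodule K V} (hT : IsMaxTotallyIsotropic B T)
    (h : 2 < Nat.card K ∨ 2 = Nat.card K ∧ 3 ≤ finrank K T) :
    (orthoGraph B hB).cliqueNum =
      Nat.card K ^ finrank K T + (finrank K V - 2 * finrank K T) := by
  have hTV : 2 * finrank K T ≤ finrank K V := by
    have := hT.isotropic.two_mul_finrank_add_card_le hnd (N := ∅) ⟨by simp, by simp⟩ (by simp)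
    simpa using this
  refine le_antisymm (cliqueNum_orthoGraph_le hB hnd fun S k hS hk => ?_) ?_
  · exact le_trans (by omega) (pow_add_sub_le_pow_add_sub h (hT.finrank_le S hS) hTV)
  · obtain ⟨N, hN, hNc, hNT⟩ := hT.exists_frame hB hnd
      (k := finrank K V - 2 * finrank K T) (by omega)
    rw [← hNc]
    exact le_cliqueNum_orthoGraph hB hT.isotropic hN hNT

theorem cliqueNum_orthoGraph_of_card_eq_two [FiniteDimensional K V] (hB : B.IsSymm)
    (hnd : B.Nondegenerate) (hK : Nat.card K = 2) (hne : ∃ x, B x x ≠ 0) (hV : finrank K V ≤ 5) :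
    (orthoGraph B hB).cliqueNum = finrank K V + 1 := by
  have : Finite K := Nat.finite_of_card_ne_zero (by omega)
  refine le_antisymm (cliqueNum_orthoGraph_le hB hnd fun S k hS hk => ?_) ?_
  · rw [hK]
    generalize finrank K S = d at hk
    have : d ≤ 2 := by omega
    interval_cases d <;> omega
  · obtain ⟨N, hN, hNc⟩ := exists_frame_card_eq_finrank hB hnd hK hne
    have h0 : IsTotallyIsotropic B (⊥ : Submodule K V) := fun x hx y _ => by
      rw [(Submodule.mem_bot K).1 hx, map_zero, LinearMap.zero_apply]
    have := le_cliqueNum_orthoGraph hB h0 hN (by simp)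
    rw [finrank_bot, pow_zero, hNc] at this
    omega

end Forms

/-! ### Scaled trace forms -/

section Trace

variable (K : Type*) {L : Type*} [Field K] [Field L] [Algebra K L]

/-- The bilinear form `(x, y) ↦ Tr (c * x * y)` on `L` over `K`. -/
noncomputable def scaledTraceForm (c : L) : LinearMap.BilinForm K L :=
  (Algebra.traceForm K L).compLeft (LinearMap.mulLeft K c)

variable {K}

theorem scaledTraceForm_apply (c x y : L) :
    scaledTraceForm K c x y = Algebra.trace K L (c * x * y) := rfl

theorem scaledTraceForm_isSymm (c : L) : (scaledTraceForm K c).IsSymm :=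
  ⟨fun x y => by rw [scaledTraceForm_apply, scaledTraceForm_apply, mul_right_comm]⟩

theorem eq_zero_of_trace_mul_eq_zero [FiniteDimensional K L] [Algebra.IsSeparable K L] {c : L}
    (h : ∀ x, Algebra.trace K L (c * x) = 0) : c = 0 :=
  (traceForm_nondegenerate K L).1 c h

theorem scaledTraceForm_nondegenerate [FiniteDimensional K L] [Algebra.IsSeparable K L] {c : L}
    (hc : c ≠ 0) : (scaledTraceForm K c).Nondegenerate := by
  have h : ∀ x, (∀ y, scaledTraceForm K c x y = 0) → x = 0 := fun x hx =>
    (mul_eq_zero.1 (eq_zero_of_trace_mul_eq_zero (K := K) hx)).resolve_left hc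
  exact ⟨h, fun y hy => h y fun x =>
    ((scaledTraceForm_isSymm (K := K) c).eq y x).trans (hy x)⟩

/-- Every hyperplane of `L` is the kernel of `x ↦ Tr (c * x)` for some `c ≠ 0`, since the trace form
identifies `L` with its dual. -/
theorem exists_eq_ker_trace_mul [FiniteDimensional K L] [Algebra.IsSeparable K L]
    {U : Submodule K L} (hU : finrank K U + 1 = finrank K L) :
    ∃ c : L, c ≠ 0 ∧ ∀ x, x ∈ U ↔ Algebra.trace K L (c * x) = 0 := by
  have hlt : U < ⊤ := lt_top_iff_ne_top.2 fun h => by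
    rw [h, finrank_top] at hU
    omega
  obtain ⟨f, hf, hUf⟩ := U.exists_le_ker_of_lt_top hlt
  have hker : U = LinearMap.ker f := by
    refine Submodule.eq_of_le_of_finrank_le hUf ?_
    have h1 := f.finrank_range_add_finrank_ker
    rw [LinearMap.range_eq_top.2 (LinearMap.surjective hf), finrank_top, finrank_self] at h1
    omega
  have hnd := traceForm_nondegenerate K L
  obtain ⟨c, hc⟩ := ((Algebra.traceForm K L).toDual hnd).surjective f
  have hfc : ∀ x, f x = Algebra.trace K L (c * x) := fun x => by
    rw [← hc, LinearMap.BilinForm.toDual_def, Algebra.traceForm_apply]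
  refine ⟨c, ?_, fun x => by rw [hker, LinearMap.mem_ker, hfc]⟩
  rintro rfl
  exact hf (LinearMap.ext fun x => by simp [hfc])

theorem prodGraph_eq_orthoGraph {U : Submodule K L} {c : L}
    (hU : ∀ x, x ∈ U ↔ Algebra.trace K L (c * x) = 0) :
    prodGraph U = orthoGraph (scaledTraceForm K c) (scaledTraceForm_isSymm c) := by
  ext a b
  simp only [prodGraph, orthoGraph, hU, scaledTraceForm_apply, mul_assoc]

/-- In characteristic two a nonzero scaled trace form is not alternating, because every element of
`L` is a square. -/
theorem exists_scaledTraceForm_self_ne_zero [Finite L] [FiniteDimensional K L]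
    [Algebra.IsSeparable K L] (hL : ringChar L = 2) {c : L} (hc : c ≠ 0) :
    ∃ x, scaledTraceForm K c x x ≠ 0 := by
  by_contra! h
  refine hc (eq_zero_of_trace_mul_eq_zero (K := K) fun x => ?_)
  obtain ⟨y, rfl⟩ := FiniteField.isSquare_of_char_two hL x
  rw [← mul_assoc]
  exact h y

/-- Two trace functionals with the same kernel are proportional: if `x ↦ Tr (c * x)` vanishes on the
elements of trace zero, then `c` lies in `K`. -/
theorem exists_eq_algebraMap_of_ker_trace_le [FiniteDimensional K L] [Algebra.IsSeparable K L]
    {c : L} (h : ∀ x, Algebra.trace K L x = 0 → Algebra.trace K L (c * x) = 0) :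
    ∃ r : K, c = algebraMap K L r := by
  obtain ⟨y, hy⟩ := Algebra.trace_surjective K L 1
  refine ⟨Algebra.trace K L (c * y), sub_eq_zero.1 (eq_zero_of_trace_mul_eq_zero (K := K)
    fun x => ?_)⟩
  have h1 := h (x - Algebra.trace K L x • y) (by rw [map_sub, map_smul, hy]; simp)
  rw [mul_sub, map_sub, mul_smul_comm, map_smul, smul_eq_mul] at h1
  rw [sub_mul, map_sub, ← Algebra.smul_def, map_smul, smul_eq_mul, mul_comm (Algebra.trace K L _)]
  exact h1

/-- The form `(x, y) ↦ Tr (c * x * y)` is hyperbolic: it has a totally isotropic subspace of half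
the dimension of `L`. Here `c` is not required to be nonzero. -/
def IsHyperbolicScale (K : Type*) {L : Type*} [Field K] [Field L] [Algebra K L] (c : L) : Prop :=
  ∃ T : Submodule K L, IsTotallyIsotropic (scaledTraceForm K c) T ∧
    2 * finrank K T = finrank K L

theorem IsHyperbolicScale.mul_sq {c b : L} (hb : b ≠ 0) (h : IsHyperbolicScale K c) :
    IsHyperbolicScale K (c * (b * b)) := by
  obtain ⟨T, hT, hd⟩ := h
  refine ⟨T.map (LinearMap.mulLeft K b⁻¹), ?_, ?_⟩
  · rintro _ ⟨x, hx, rfl⟩ _ ⟨y, hy, rfl⟩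
    rw [← hT x hx y hy, scaledTraceForm_apply, scaledTraceForm_apply]
    congr 1
    simp only [LinearMap.mulLeft_apply]
    field_simp
  · rw [← hd]
    congr 1
    exact (Submodule.equivMapOfInjective _
      (fun _ _ h => mul_left_cancel₀ (inv_ne_zero hb) h) T).finrank_eq.symm

theorem isSquare_mul_of_not_isSquare {F : Type*} [Field F] [Finite F] {c d : F}
    (hF : ringChar F ≠ 2) (hc : ¬ IsSquare c) (hd : ¬ IsSquare d) : IsSquare (c * d) := by
  have := Fintype.ofFinite F
  have hc0 : c ≠ 0 := fun h => hc (h ▸ IsSquare.zero)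
  have hd0 : d ≠ 0 := fun h => hd (h ▸ IsSquare.zero)
  rw [FiniteField.isSquare_iff hF (mul_ne_zero hc0 hd0), mul_pow,
    (FiniteField.pow_dichotomy hF hc0).resolve_left fun h =>
      hc ((FiniteField.isSquare_iff hF hc0).2 h),
    (FiniteField.pow_dichotomy hF hd0).resolve_left fun h =>
      hd ((FiniteField.isSquare_iff hF hd0).2 h)]
  norm_num

/-- In odd characteristic, hyperbolicity depends only on the square class of the scale. -/
theorem IsHyperbolicScale.of_isSquare_iff [Finite L] (hL : ringChar L ≠ 2) {c d : L}
    (hc : c ≠ 0) (hd : d ≠ 0) (h : IsHyperbolicScale K c) (hcd : IsSquare c ↔ IsSquare d) :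
    IsHyperbolicScale K d := by
  have hsq : IsSquare (c * d) := by
    by_cases hs : IsSquare c
    · exact hs.mul (hcd.1 hs)
    · exact isSquare_mul_of_not_isSquare hL hs fun h => hs (hcd.2 h)
  obtain ⟨e, he⟩ := hsq
  have he0 : e ≠ 0 := fun h0 => mul_ne_zero hc hd (by rw [he, h0, mul_zero])
  have hde : d = c * (e / c * (e / c)) := by
    field_simp
    rw [pow_two, ← he, mul_comm]
  rw [hde]
  exact h.mul_sq (div_ne_zero he0 hc)

end Trace

/-! ### Square classes and hyperbolicity over finite fields -/

section FiniteFields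

variable {K L : Type*} [Field K] [Finite K] [Field L] [Finite L] [Algebra K L]

/-- In an extension of even degree of a finite field, every element of the base field is a square:
`(q ^ n - 1) / 2` is then a multiple of `q - 1`. -/
theorem isSquare_algebraMap_of_even_finrank (hK : Odd (Nat.card K)) (hn : Even (finrank K L))
    (r : K) : IsSquare (algebraMap K L r) := by
  have := Fintype.ofFinite K
  have := Fintype.ofFinite L
  rcases eq_or_ne r 0 with rfl | hr
  · exact ⟨0, by simp⟩
  have hcard : Fintype.card L = Fintype.card K ^ finrank K L := Module.card_eq_pow_finrank
  rw [Nat.card_eq_fintype_card] at hK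
  have hodd : Odd (Fintype.card L) := hcard ▸ hK.pow
  have hchar : ringChar L ≠ 2 := fun h => by
    have := FiniteField.even_card_iff_char_two.1 h
    have := Nat.odd_iff.1 hodd
    omega
  rw [FiniteField.isSquare_iff hchar (by simpa using hr)]
  obtain ⟨m, hm⟩ := hn
  have hdvd : Fintype.card K ^ 2 - 1 ∣ Fintype.card L - 1 := by
    have := Nat.sub_dvd_pow_sub_pow (Fintype.card K ^ 2) 1 m
    rwa [one_pow, ← pow_mul, two_mul, ← hm, ← hcard] at this
  obtain ⟨k, hk⟩ := hK
  obtain ⟨j, hj⟩ := hdvd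
  -- `#K = 2 * k + 1` and `#L - 1 = (#K ^ 2 - 1) * j`.
  have e1 : Fintype.card L / 2 = (Fintype.card K - 1) * ((k + 1) * j) := by
    have h1 : Fintype.card K ^ 2 - 1 = 2 * (2 * k * (k + 1)) := by
      rw [hk]; apply Nat.sub_eq_of_eq_add; ring
    have h2 : Fintype.card L = 2 * (2 * k * ((k + 1) * j)) + 1 := by
      have := Fintype.card_pos (α := L)
      rw [h1] at hj
      have : 2 * (2 * k * (k + 1)) * j = 2 * (2 * k * ((k + 1) * j)) := by ring
      omega
    have h3 : Fintype.card K - 1 = 2 * k := by omega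
    rw [h3]; omega
  rw [e1, pow_mul, ← map_pow, FiniteField.pow_card_sub_one_eq_one r hr, map_one, one_pow]

/-- The sign of `ker (x ↦ Tr (c * x))` records whether `c` is a square: the condition
`U = a² ker Tr` determines `c` up to a factor in `K`, and such a factor is a square in `L`. -/
theorem subspaceSign_eq_one_iff {U : Submodule K L} {c : L} (hc : c ≠ 0)
    (hU : ∀ x, x ∈ U ↔ Algebra.trace K L (c * x) = 0)
    (hK : Odd (Nat.card K)) (hn : Even (finrank K L)) :
    subspaceSign U = 1 ↔ IsSquare c := by
  have hmem : ∀ {a : L} (_ : a ≠ 0) (x : L), x ∈ mulSubspace (a ^ 2) (traceZero K L) ↔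
      Algebra.trace K L ((a ^ 2)⁻¹ * x) = 0 := by
    intro a ha x
    simp only [mulSubspace, traceZero, Submodule.mem_map, LinearMap.mem_ker,
      LinearMap.mulLeft_apply]
    constructor
    · rintro ⟨y, hy, rfl⟩
      rwa [inv_mul_cancel_left₀ (pow_ne_zero 2 ha)]
    · intro h
      exact ⟨_, h, mul_inv_cancel_left₀ (pow_ne_zero 2 ha) x⟩
  have hsign : subspaceSign U = 1 ↔
      ∃ a : L, a ≠ 0 ∧ U = mulSubspace (a ^ 2) (traceZero K L) := by
    unfold subspaceSign
    split_ifs with h <;> simp [h]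
  rw [hsign]
  constructor
  · rintro ⟨a, ha, rfl⟩
    obtain ⟨r, hr⟩ := exists_eq_algebraMap_of_ker_trace_le (K := K) (c := c * a ^ 2) fun x hx => by
      rw [mul_assoc, ← hU, hmem ha, inv_mul_cancel_left₀ (pow_ne_zero 2 ha), hx]
    have hcr : c = algebraMap K L r * (a⁻¹ * a⁻¹) := by
      rw [← hr]; field_simp
    rw [hcr]
    exact (isSquare_algebraMap_of_even_finrank hK hn r).mul (IsSquare.mul_self _)
  · rintro ⟨b, rfl⟩
    have hb : b ≠ 0 := fun h => hc (by rw [h, mul_zero])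
    refine ⟨b⁻¹, inv_ne_zero hb, Submodule.ext fun x => ?_⟩
    rw [hU, hmem (inv_ne_zero hb)]
    simp [pow_two]

/-- Let `σ x = x ^ (q ^ m)`, the `K`-automorphism of `L` of order two. If `σ c = -c`, then the
subfield fixed by `σ` is totally isotropic of half the dimension: for `x`, `y` fixed by `σ`, applying `σ` negates
`c * x * y` but preserves its trace. -/
theorem isHyperbolicScale_of_pow_eq_neg (hK : Odd (Nat.card K)) {m : ℕ}
    (hm : finrank K L = 2 * m) {c : L} (hc : c ≠ 0) (hcQ : c ^ (Nat.card K ^ m) = -c) :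
    IsHyperbolicScale K c := by
  have := Fintype.ofFinite K
  have := Fintype.ofFinite L
  rw [Nat.card_eq_fintype_card] at hK hcQ
  have h2 : (2 : K) ≠ 0 := by
    apply Ring.two_ne_zero
    intro h
    have := FiniteField.even_card_iff_char_two.1 h
    have := Nat.odd_iff.1 hK
    omega
  set σ : L ≃ₐ[K] L := FiniteField.frobeniusAlgEquivOfAlgebraic K L ^ m with hσdef
  have hσ : ∀ x, σ x = x ^ (Fintype.card K ^ m) := fun x => by
    rw [hσdef, AlgEquiv.coe_pow, FiniteField.coe_frobeniusAlgEquivOfAlgebraic_iterate]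
  have hσσ : ∀ x, σ (σ x) = x := fun x => by
    rw [hσ, hσ, ← pow_mul, ← pow_add, ← two_mul, ← hm, ← Module.card_eq_pow_finrank,
      FiniteField.pow_card]
  have hσc : σ c = -c := by rw [hσ, hcQ]
  set f : L →ₗ[K] L := σ.toLinearMap - LinearMap.id with hf
  set g : L →ₗ[K] L := σ.toLinearMap + LinearMap.id with hg
  have hfx : ∀ x, f x = σ x - x := fun x => rfl
  have hgx : ∀ x, g x = σ x + x := fun x => rfl
  have hT : IsTotallyIsotropic (scaledTraceForm K c) (LinearMap.ker f) := by
    intro x hx y hy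
    rw [LinearMap.mem_ker, hfx, sub_eq_zero] at hx hy
    have h1 : Algebra.trace K L (σ (c * x * y)) = Algebra.trace K L (c * x * y) :=
      Algebra.trace_eq_of_algEquiv σ _
    rw [map_mul σ, map_mul σ, hx, hy, hσc, neg_mul, neg_mul, map_neg] at h1
    have h3 : 2 * Algebra.trace K L (c * x * y) = 0 := by linear_combination -h1
    exact (mul_eq_zero.1 h3).resolve_left h2
  refine ⟨LinearMap.ker f, hT, le_antisymm ?_ ?_⟩
  · simpa using hT.two_mul_finrank_add_card_le (scaledTraceForm_nondegenerate hc)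
      (N := ∅) ⟨by simp, by simp⟩ (by simp)
  · have h1 := f.finrank_range_add_finrank_ker
    have h3 : LinearMap.range f ≤ LinearMap.ker g := by
      rintro _ ⟨x, rfl⟩
      rw [LinearMap.mem_ker, hgx, hfx, map_sub, hσσ]
      ring
    -- Multiplication by `c` carries the `(-1)`-eigenspace of `σ` into the fixed field.
    have h4 : (LinearMap.ker g).map (LinearMap.mulLeft K c) ≤ LinearMap.ker f := by
      rintro _ ⟨x, hx, rfl⟩
      have hx' : σ x + x = 0 := hx
      rw [LinearMap.mem_ker, hfx, LinearMap.mulLeft_apply, map_mul, hσc]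
      linear_combination (-c) * hx'
    have h5 := Submodule.finrank_mono h3
    have h6 := Submodule.finrank_mono h4
    rw [← (Submodule.equivMapOfInjective _
      (fun _ _ h => mul_left_cancel₀ hc h) (LinearMap.ker g)).finrank_eq] at h6
    omega

/-- With `Q = q ^ m` and `g` a nonsquare of `L`, the element `c = g ^ ((Q + 1) / 2)` satisfies
`c ^ Q = -c`, and it is a square exactly when `(Q + 1) / 2` is even. -/
theorem exists_isHyperbolicScale (hK : Odd (Nat.card K)) {m : ℕ} (hm : finrank K L = 2 * m) :
    ∃ c : L, c ≠ 0 ∧ (IsSquare c ↔ Nat.card K ^ m % 4 = 3) ∧ IsHyperbolicScale K c := by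
  have := Fintype.ofFinite K
  have := Fintype.ofFinite L
  have hQ : Odd (Nat.card K ^ m) := hK.pow
  have hcard : Fintype.card L = Nat.card K ^ m * Nat.card K ^ m := by
    rw [← Nat.card_eq_fintype_card, Module.natCard_eq_pow_finrank (K := K), hm, two_mul, pow_add]
  have hchar : ringChar L ≠ 2 := fun h => by
    have h1 := FiniteField.even_card_iff_char_two.1 h
    rw [hcard] at h1
    have := Nat.odd_iff.1 (hQ.mul hQ)
    omega
  obtain ⟨g, hg⟩ := FiniteField.exists_nonsquare hchar
  have hg0 : g ≠ 0 := fun h => hg (h ▸ IsSquare.zero)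
  have hg1 : g ^ (Fintype.card L / 2) = -1 := (FiniteField.pow_dichotomy hchar hg0).resolve_left
    fun h => hg ((FiniteField.isSquare_iff hchar hg0).2 h)
  obtain ⟨k, hk⟩ := hQ
  -- With `Q = 2 * k + 1`, this reads `(Q ^ 2 - 1) / 2 = (Q + 1) / 2 * (Q - 1)`.
  have e1 : Fintype.card L / 2 = (k + 1) * (2 * k) := by
    have : Fintype.card L = 2 * ((k + 1) * (2 * k)) + 1 := by rw [hcard, hk]; ring
    omega
  have hneg : (-1 : L) ≠ 1 := Ring.neg_one_ne_one_of_char_ne_two hchar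
  refine ⟨g ^ (k + 1), pow_ne_zero _ hg0, ?_,
    isHyperbolicScale_of_pow_eq_neg hK hm (pow_ne_zero _ hg0) ?_⟩
  · rw [FiniteField.isSquare_iff hchar (pow_ne_zero _ hg0), ← pow_mul, mul_comm, pow_mul, hg1,
      neg_one_pow_eq_one_iff_even hneg, Nat.even_iff, hk]
    omega
  · rw [hk, pow_succ (g ^ (k + 1)), ← pow_mul, ← e1, hg1, neg_one_mul]

/-- The number of zeros of `x ↦ Tr (c * x * x)`, averaged over all `c ≠ 0`, is exactly `#L / #K`,
while a hyperbolic form has more zeros than that; so some scale is not hyperbolic. -/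
theorem exists_not_isHyperbolicScale (hK : Odd (Nat.card K)) :
    ∃ c : L, c ≠ 0 ∧ ¬ IsHyperbolicScale K c := by
  classical
  have := Fintype.ofFinite K
  have := Fintype.ofFinite L
  have h2 : (2 : K) ≠ 0 := by
    apply Ring.two_ne_zero
    intro h
    have := FiniteField.even_card_iff_char_two.1 h
    rw [Nat.card_eq_fintype_card] at hK
    have := Nat.odd_iff.1 hK
    omega
  by_contra! hall
  have htr : Algebra.trace K L ≠ 0 := fun h0 => by
    obtain ⟨y, hy⟩ := Algebra.trace_surjective K L 1
    rw [h0] at hy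
    exact zero_ne_one hy
  -- For `x ≠ 0`, the zeros of `c ↦ Tr (c * x * x)` are the kernel of a nonzero functional.
  have hx : ∀ x : L, x ≠ 0 → Fintype.card K *
      (Finset.univ.filter fun c : L => scaledTraceForm K c x x = 0).card = Fintype.card L := by
    intro x hx
    rw [card_eq_mul_card_fiber (f := Algebra.trace K L ∘ₗ LinearMap.mulLeft K (x * x)) (fun h0 => by
      apply mul_ne_zero hx hx
      exact eq_zero_of_trace_mul_eq_zero (K := K) fun y => LinearMap.congr_fun h0 y) 0]
    refine congrArg _ (congrArg _ (Finset.filter_congr fun c _ => ?_))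
    rw [scaledTraceForm_apply, mul_assoc, mul_comm]
    rfl
  have hcnt : ∀ c ∈ Finset.univ.erase (0 : L), Fintype.card L < Fintype.card K *
      (Finset.univ.filter fun x : L => scaledTraceForm K c x x = 0).card := by
    intro c hc
    have hc0 := Finset.ne_of_mem_erase hc
    obtain ⟨T, hT, hd⟩ := hall c hc0
    exact hT.card_lt_mul_card_isotropic (scaledTraceForm_isSymm c)
      (scaledTraceForm_nondegenerate hc0) h2 hd
  have hlt := Finset.sum_lt_sum_of_nonempty ⟨1, by simp⟩ hcnt
  have hdouble : ∑ c : L, Fintype.card K *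
        (Finset.univ.filter fun x : L => scaledTraceForm K c x x = 0).card =
      ∑ x : L, Fintype.card K *
        (Finset.univ.filter fun c : L => scaledTraceForm K c x x = 0).card := by
    simp_rw [← Finset.mul_sum, Finset.card_filter]
    rw [Finset.sum_comm]
  -- The terms `c = 0` on the left and `x = 0` on the right are both `#K * #L` and cancel.
  rw [← Finset.add_sum_erase _ _ (Finset.mem_univ (0 : L)),
    ← Finset.add_sum_erase _ _ (Finset.mem_univ (0 : L))] at hdouble
  have hz1 : (Finset.univ.filter fun x : L => scaledTraceForm K (0 : L) x x = 0) =
      Finset.univ := Finset.filter_true_of_mem fun x _ => by simp [scaledTraceForm_apply]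
  have hz2 : (Finset.univ.filter fun c : L => scaledTraceForm K c (0 : L) 0 = 0) =
      Finset.univ := Finset.filter_true_of_mem fun c _ => by simp
  rw [hz1, hz2, add_right_inj] at hdouble
  rw [hdouble, Finset.sum_congr rfl fun x hx' => hx x (Finset.ne_of_mem_erase hx')] at hlt
  exact lt_irrefl _ hlt

/-- Exactly one of the two square classes consists of hyperbolic scales, and
`exists_isHyperbolicScale` tells which. -/
theorem isHyperbolicScale_iff (hK : Odd (Nat.card K)) {m : ℕ} (hm : finrank K L = 2 * m)
    {c : L} (hc : c ≠ 0) :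
    IsHyperbolicScale K c ↔ (IsSquare c ↔ Nat.card K ^ m % 4 = 3) := by
  have := Fintype.ofFinite L
  have hL : ringChar L ≠ 2 := fun h => by
    have h1 := FiniteField.even_card_iff_char_two.1 h
    rw [← Nat.card_eq_fintype_card, Module.natCard_eq_pow_finrank (K := K)] at h1
    have := Nat.odd_iff.1 (hK.pow (n := finrank K L))
    omega
  obtain ⟨c₁, hc₁, hsq₁, hyp₁⟩ := exists_isHyperbolicScale (L := L) hK hm
  obtain ⟨c₂, hc₂, hyp₂⟩ := exists_not_isHyperbolicScale (K := K) (L := L) hK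
  constructor
  · intro h
    by_contra hne
    have : ¬ (IsSquare c ↔ IsSquare c₁) := by rwa [hsq₁]
    by_cases h3 : IsSquare c₁ ↔ IsSquare c₂
    · exact hyp₂ (hyp₁.of_isSquare_iff hL hc₁ hc₂ h3)
    · exact hyp₂ (h.of_isSquare_iff hL hc hc₂ (by tauto))
  · intro h
    exact hyp₁.of_isSquare_iff hL hc₁ hc (hsq₁.trans h.symm)

end FiniteFields

/-! ### Clique numbers of the graphs of hyperplanes -/

theorem mainTheorem1 {K L : Type*} [Field K] [Finite K] [Field L] [Finite L] [Algebra K L]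
    (q n : ℕ) (hq : Nat.card K = q) (hn : Module.finrank K L = n) (hn2 : 2 ≤ n)
    (U : Submodule K L) (hU : Module.finrank K U = n - 1) :
    (2 < q ∨ 6 ≤ n →
      (Even q ∨ Odd n →
        (prodGraph U).cliqueNum = q ^ (n / 2) + (n - 2 * (n / 2))) ∧
      (Odd q → Even n →
        ((q % 4, n % 4, subspaceSign U) ∈
            ({(1, 0, -1), (3, 0, -1), (3, 2, 1), (1, 2, -1)} : Set (ℕ × ℕ × ℤ)) →
          (prodGraph U).cliqueNum = q ^ (n / 2)) ∧
        ((q % 4, n % 4, subspaceSign U) ∈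
            ({(1, 0, 1), (3, 0, 1), (3, 2, -1), (1, 2, 1)} : Set (ℕ × ℕ × ℤ)) →
          (prodGraph U).cliqueNum = q ^ (n / 2 - 1) + 2))) ∧
    (q = 2 → n ≤ 5 → (prodGraph U).cliqueNum = n + 1) := by
  subst hq hn
  obtain ⟨c, hc, hUc⟩ := exists_eq_ker_trace_mul (U := U) (by omega)
  have hB := scaledTraceForm_isSymm (K := K) c
  have hnd := scaledTraceForm_nondegenerate (K := K) hc
  have hq1 : 1 < Nat.card K := Finite.one_lt_card
  rw [prodGraph_eq_orthoGraph hUc]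
  obtain ⟨T, hT⟩ := exists_isMaxTotallyIsotropic (scaledTraceForm K c)
  have hle : 2 * finrank K T ≤ finrank K L := by
    simpa using hT.isotropic.two_mul_finrank_add_card_le hnd (N := ∅) ⟨by simp, by simp⟩ (by simp)
  have hge := hT.finrank_le_add_two hB hnd
  refine ⟨fun hA => ⟨fun h => ?_, fun hodd heven => ?_⟩, fun h2 h5 => ?_⟩
  · have hd : finrank K T = finrank K L / 2 := by
      rcases h with h | h
      · have := hT.finrank_le_add_one hB hnd h
        omega
      · have := Nat.odd_iff.1 h
        omega
    rw [hT.cliqueNum_orthoGraph hB hnd (by omega), hd]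
  · have h3 : 2 < Nat.card K := by
      have := Nat.odd_iff.1 hodd
      omega
    have hcl := hT.cliqueNum_orthoGraph hB hnd (Or.inl h3)
    obtain ⟨m, hm⟩ := heven
    rw [← two_mul] at hm
    have hsign := subspaceSign_eq_one_iff hc hUc hodd ⟨m, by omega⟩
    have hyp := isHyperbolicScale_iff hodd hm hc
    rw [← hsign] at hyp
    -- Squares of odd numbers are `1` modulo `4`, so only the parity of `m` matters.
    have hQ : Nat.card K ^ m % 4 = 3 ↔ Nat.card K % 4 = 3 ∧ m % 2 = 1 := by
      have hK4 := Nat.odd_mod_four_iff.1 (Nat.odd_iff.1 hodd)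
      rw [Nat.pow_mod]
      obtain ⟨k, rfl | rfl⟩ := Nat.even_or_odd' m
      · rw [pow_mul, Nat.pow_mod]
        rcases hK4 with h | h <;> simp [h]
      · rw [pow_succ, pow_mul, Nat.mul_mod, Nat.pow_mod]
        rcases hK4 with h | h <;> simp [h]
    rw [hQ] at hyp
    refine ⟨fun hmem => ?_, fun hmem => ?_⟩
    · have hT' : IsHyperbolicScale K c := by
        rw [hyp]
        simp only [Set.mem_insert_iff, Set.mem_singleton_iff, Prod.mk.injEq] at hmem
        omega
      obtain ⟨S, hS, hSd⟩ := hT'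
      have := hT.finrank_le S hS
      have hd : finrank K T = finrank K L / 2 := by omega
      rw [hcl, hd]
      omega
    · have hT' : ¬ IsHyperbolicScale K c := by
        rw [hyp]
        simp only [Set.mem_insert_iff, Set.mem_singleton_iff, Prod.mk.injEq] at hmem
        omega
      have hne : 2 * finrank K T ≠ finrank K L := fun h => hT' ⟨T, hT.isotropic, h⟩
      have hd : finrank K T = finrank K L / 2 - 1 := by omega
      rw [hcl, hd]
      omega
  · have := Fintype.ofFinite L
    have hchar : ringChar L = 2 := FiniteField.even_card_iff_char_two.2 (by
      rw [← Nat.card_eq_fintype_card, Module.natCard_eq_pow_finrank (K := K), h2, Nat.pow_mod]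
      simp [show finrank K L ≠ 0 by omega])
    exact cliqueNum_orthoGraph_of_card_eq_two hB hnd h2
      (exists_scaledTraceForm_self_ne_zero hchar hc) h5
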